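/- Let $1 < a_2 < a_3$ be integers and $A = \{1, a_2, a_3\}$. For an integer $h \ge 0$, say that $x$ has an $h$-representation if $x = c_3 a_3 + c_2 a_2 + c_1$ for some integers $c_1, c_2, c_3 \ge 0$ with $c_1 + c_2 + c_3 \le h$. Let the $h$-range $X(h)$ be one less than the smallest non-negative integer that has no $h$-representation, and call $A$ admissible for $h$ if $X(h) \ge a_3$. Then, for every $h$ for which $A$ is admissible, $$X(h+1) = X(h) + a_3 .$$ Consequently, let $h_0$ be the smallest $h$ for which $A$ is admissible, and let $h_1$ be the smallest value such that $X(h+1) = X(h) + a_3$ for all $h \ge h_1$. Both of these exist, and $h_1 \le h_0$. -/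

import Mathlib

namespace HBasis

/-- `x` has an `h`-representation over `{1, a₂, a₃}`: it is the sum of at most `h` elements,
repetitions allowed. -/
def HasRep (a₂ a₃ h x : ℕ) : Prop :=
  ∃ c₁ c₂ c₃ : ℕ, x = c₃ * a₃ + c₂ * a₂ + c₁ ∧ c₁ + c₂ + c₃ ≤ h

/-- The `h`-range: one less than the smallest natural number without an `h`-representation
(that number exists and is positive when `1 < a₂ < a₃`, see `isLeast_hRange_add_one`). -/
noncomputable def hRange (a₂ a₃ h : ℕ) : ℕ :=
  sInf {x : ℕ | ¬ HasRep a₂ a₃ h x} - 1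

/-- The basis `{1, a₂, a₃}` is admissible for `h`. -/
def Admissible (a₂ a₃ h : ℕ) : Prop :=
  a₃ ≤ hRange a₂ a₃ h

/-- `h₀` is the smallest `h` for which the basis is admissible. -/
def IsHZero (a₂ a₃ h₀ : ℕ) : Prop :=
  IsLeast {h : ℕ | Admissible a₂ a₃ h} h₀

/-- `h₁` is the smallest value such that `X(h + 1) = X(h) + a₃` for all `h ≥ h₁`. -/
def IsHOne (a₂ a₃ h₁ : ℕ) : Prop :=
  IsLeast {m : ℕ | ∀ h : ℕ, m ≤ h → hRange a₂ a₃ (h + 1) = hRange a₂ a₃ h + a₃} h₁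

/-- The truncated subtraction and the infimum in `hRange` never take junk values. -/
theorem isLeast_hRange_add_one {a₂ a₃ : ℕ} (h₂ : 1 < a₂) (h₃ : a₂ < a₃) (h : ℕ) :
    IsLeast {x : ℕ | ¬ HasRep a₂ a₃ h x} (hRange a₂ a₃ h + 1) := by
  have hne : {x : ℕ | ¬ HasRep a₂ a₃ h x}.Nonempty := by
    refine ⟨h * a₃ + 1, ?_⟩
    rintro ⟨c₁, c₂, c₃, hx, hc⟩
    nlinarith [Nat.mul_le_mul_right a₃ hc, Nat.mul_le_mul_left c₂ h₃.le,
      Nat.mul_le_mul_left c₁ (show 1 ≤ a₃ by omega)]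
  have hmem := Nat.sInf_mem hne
  have hpos : sInf {x : ℕ | ¬ HasRep a₂ a₃ h x} ≠ 0 := by
    intro h0
    rw [h0] at hmem
    exact hmem ⟨0, 0, 0, by simp, by simp⟩
  have heq : hRange a₂ a₃ h + 1 = sInf {x : ℕ | ¬ HasRep a₂ a₃ h x} := by
    unfold hRange
    omega
  rw [heq]
  exact ⟨hmem, fun x hx => Nat.sInf_le hx⟩

end HBasis

namespace HBasis

/-! Adding a copy of `a₃` gives `X(h+1) ≥ X(h) + a₃`. For the converse, deleting an `a₃` from an
`(h+1)`-representation of `X(h) + 1 + a₃` would represent `X(h) + 1`, so only representations over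
`{1, a₂}` matter. `exists_rep_using_largest` trades these for one containing `a₃`, since
admissibility gives `h + 1 ≥ a₂ + ⌊a₃/a₂⌋ - 1`. If every trade were too long, the residues of `m - j
* a₃` mod `a₂` would be too spread out to fit below `a₂` (`orbit_packing`). -/

/-- If the orbit `v j = (m - j * a) % b` stays at distance at least `d` above `v 0` for
`1 ≤ j ≤ N` and attains the distance `d` at `p`, then the first `N - p` points of the orbit start
disjoint intervals of length `d` avoiding the remaining points. -/
theorem orbit_packing {m a b d : ℤ} (hb : 0 < b) {N i p : ℕ} (hip : i + p ≤ N) (hp : 1 ≤ p)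
    (hd : 0 < d) (hmin : ∀ j : ℕ, 1 ≤ j → j ≤ N → m % b + d ≤ (m - j * a) % b)
    (hpd : (m - p * a) % b = m % b + d) :
    m % b + (i + 1) * d + (N - i) ≤ b := by
  set v : ℕ → ℤ := fun j => (m - j * a) % b with hv
  have hv0 : v 0 = m % b := by simp [hv]
  have hnonneg : ∀ j, 0 ≤ v j := fun j => Int.emod_nonneg _ hb.ne'
  have hlt : ∀ j, v j < b := fun j => Int.emod_lt_of_pos _ hb
  have hval : ∀ j, ∃ k : ℤ, m - j * a = v j + b * k := fun j =>
    ⟨(m - j * a) / b, (Int.emod_add_mul_ediv _ _).symm⟩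
  have hdet : ∀ (j : ℕ) (x : ℤ), 0 ≤ x → x < b → (∃ k : ℤ, m - j * a = x + b * k) → v j = x := by
    rintro j x hx0 hxb ⟨k, hk⟩
    simp only [hv, hk, Int.add_mul_emod_self_left]
    exact Int.emod_eq_of_lt hx0 hxb
  have hmin' : ∀ j : ℕ, 1 ≤ j → j ≤ N → v 0 + d ≤ v j := by
    intro j h1 h2
    rw [hv0]
    exact hmin j h1 h2
  have hpd' : v p = v 0 + d := by rw [hv0]; exact hpd
  have hforward : ∀ j j' : ℕ, j < j' → j' ≤ N → v j ≤ v j' → v j + d ≤ v j' := by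
    intro j j' hjj hN hle
    by_contra hcon
    obtain ⟨k, hk⟩ := hval j
    obtain ⟨k', hk'⟩ := hval j'
    obtain ⟨k0, hk0⟩ := hval 0
    -- Translating the short gap to start at `v 0` gives an orbit point closer than `d`.
    have := hdet (j' - j) (v 0 + (v j' - v j)) (by linarith [hnonneg 0])
      (by linarith [hlt p]) ⟨k0 + k' - k, by
        push_cast [Nat.cast_sub hjj.le] at *
        linarith⟩
    have := hmin' (j' - j) (by omega) (by omega)
    linarith
  have hbackward : ∀ j j' : ℕ, j' < j → j ≤ i → v j < v j' → v j + d ≤ v j' := by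
    intro j j' hjj hi hle
    by_contra hcon
    obtain ⟨k, hk⟩ := hval j
    obtain ⟨k', hk'⟩ := hval j'
    obtain ⟨kp, hkp⟩ := hval p
    -- Here the gap is subtracted from `v p`; the index stays at most `p + i ≤ N`.
    have := hdet (p + (j - j')) (v p - (v j' - v j)) (by linarith [hnonneg 0])
      (by linarith [hlt p]) ⟨kp + k - k', by
        push_cast [Nat.cast_sub hjj.le] at *
        linarith⟩
    have := hmin' (p + (j - j')) (by omega) (by omega)
    linarith
  have htop : ∀ j : ℕ, j ≤ i → v j + d ≤ b := by
    intro j hi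
    by_contra hcon
    obtain ⟨k, hk⟩ := hval j
    obtain ⟨k0, hk0⟩ := hval 0
    obtain ⟨kp, hkp⟩ := hval p
    -- Moving `p` steps on adds `d` mod `b`; wrapping around would land below `d`.
    have := hdet (p + j) (v j + d - b) (by linarith)
      (by linarith [hlt p, hlt j, hnonneg 0]) ⟨kp + k - k0 + 1, by
        push_cast at *
        linarith⟩
    have := hmin' (p + j) (by omega) (by omega)
    linarith [hlt j, hnonneg 0]
  set w : ℕ → ℤ := fun j => if j ≤ i then d else 1 with hw
  have hsep : ∀ j j' : ℕ, j ≤ N → j' ≤ N → j ≠ j' → v j ≤ v j' → v j + w j ≤ v j' := by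
    intro j j' hj hj' hne hle
    rcases lt_or_gt_of_ne hne with hlt' | hgt
    · have := hforward j j' hlt' hj' hle
      simp only [hw]
      split_ifs <;> linarith
    · have hstrict : v j < v j' := by
        refine lt_of_le_of_ne hle fun heq => ?_
        have := hforward j' j hgt hj heq.ge
        linarith
      simp only [hw]
      split_ifs with hi
      · exact hbackward j j' hgt hi hstrict
      · linarith
  have hdisj : Set.PairwiseDisjoint (↑(Finset.range (N + 1)) : Set ℕ)
      fun j => Finset.Ico (v j) (v j + w j) := by
    intro j hj j' hj' hne
    simp only [Finset.coe_range, Set.mem_Iio] at hj hj'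
    refine Finset.disjoint_left.2 fun x hx hx' => ?_
    simp only [Finset.mem_Ico] at hx hx'
    rcases le_total (v j) (v j') with hle | hle
    · have := hsep j j' (by omega) (by omega) hne hle
      linarith
    · have := hsep j' j (by omega) (by omega) hne.symm hle
      linarith
  have hsub : (Finset.range (N + 1)).biUnion (fun j => Finset.Ico (v j) (v j + w j)) ⊆
      Finset.Ico (v 0) b := by
    intro x hx
    simp only [Finset.mem_biUnion, Finset.mem_range, Finset.mem_Ico] at hx ⊢
    obtain ⟨j, hj, hx1, hx2⟩ := hx
    constructor
    · rcases Nat.eq_zero_or_pos j with rfl | hpos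
      · exact hx1
      · linarith [hmin' j hpos (by omega)]
    · simp only [hw] at hx2
      split_ifs at hx2 with hi
      · linarith [htop j hi]
      · linarith [hlt j]
  have hcard := Finset.card_le_card hsub
  rw [Finset.card_biUnion hdisj] at hcard
  simp only [Int.card_Ico, add_sub_cancel_left] at hcard
  have hcardZ : ∑ j ∈ Finset.range (N + 1), w j ≤ b - v 0 := by
    have h := Int.ofNat_le.2 hcard
    push_cast at h
    rw [Int.toNat_of_nonneg (by linarith [hlt 0])] at h
    exact le_trans (Finset.sum_le_sum fun j _ => Int.self_le_toNat _) h
  have hsum : ∑ j ∈ Finset.range (N + 1), w j = (i + 1) * d + (N - i) := by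
    rw [show N + 1 = (i + 1) + (N - i) by omega, Finset.sum_range_add]
    have h1 : ∑ j ∈ Finset.range (i + 1), w j = (i + 1) * d := by
      rw [Finset.sum_congr rfl (g := fun _ => d)]
      · simp
      · intro j hj
        simp only [Finset.mem_range] at hj
        simp only [hw]
        rw [if_pos (by omega)]
    have h2 : ∑ j ∈ Finset.range (N - i), w (i + 1 + j) = (N - i : ℤ) := by
      rw [Finset.sum_congr rfl (g := fun _ => 1)]
      · simp only [Finset.sum_const, Finset.card_range, nsmul_eq_mul, mul_one]
        rw [Nat.cast_sub (by omega)]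
      · intro j _
        simp only [hw]
        rw [if_neg (by omega)]
    rw [h1, h2]
  rw [hsum, hv0] at hcardZ
  linarith

/-- For `a ≤ m`, the integer `m` has a representation over `{1, b, a}` using `a` at least once,
whose number of summands is at most the larger of `b + ⌊a / b⌋ - 1` and the number of summands
of the greedy representation over `{1, b}`. -/
theorem exists_rep_using_largest {m a b q H : ℤ} (hb : 0 < b) (hq : 1 ≤ q) (hqa : q * b ≤ a)
    (haq : a < (q + 1) * b) (ham : a ≤ m) (hgreedy : m / b + m % b ≤ H) (hH : b + q - 1 ≤ H) :
    ∃ j : ℕ, 1 ≤ j ∧ j * a ≤ m ∧ j + (m - j * a) / b + (m - j * a) % b ≤ H := by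
  by_contra! hcon
  have ha : 0 < a := by nlinarith
  set v : ℕ → ℤ := fun j => (m - j * a) % b with hv
  set u : ℕ → ℤ := fun j => (m - j * a) / b with hu
  have hnonneg : ∀ j, 0 ≤ v j := fun j => Int.emod_nonneg _ hb.ne'
  have hlt : ∀ j, v j < b := fun j => Int.emod_lt_of_pos _ hb
  have huv : ∀ j : ℕ, m - j * a = v j + b * u j := fun j => (Int.emod_add_mul_ediv _ _).symm
  have hv0 : v 0 = m % b := by simp [hv]
  have hu0 : u 0 = m / b := by simp [hu]
  have hm0 : m = v 0 + b * u 0 := by simpa using huv 0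
  rw [← hv0, ← hu0] at hgreedy
  obtain ⟨J, hJ⟩ := Int.eq_ofNat_of_zero_le (Int.ediv_nonneg (ha.le.trans ham) ha.le)
  have hJm : (J : ℤ) * a ≤ m := by
    rw [← Int.le_ediv_iff_mul_le ha, hJ]
  have hmJ : m < (J + 1) * a := by
    rw [← Int.ediv_lt_iff_lt_mul ha, hJ]
    linarith
  have hJ1 : 1 ≤ J := by
    have : 1 ≤ m / a := by rw [Int.le_ediv_iff_mul_le ha]; linarith
    omega
  have hlong : ∀ j : ℕ, 1 ≤ j → j ≤ J → H < j + u j + v j := by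
    intro j h1 h2
    refine hcon j h1 (le_trans ?_ hJm)
    have : (j : ℤ) ≤ J := by exact_mod_cast h2
    nlinarith
  -- Otherwise `j` copies of `a` replace at least `j * q` copies of `b`, with no more ones.
  have habove : ∀ j : ℕ, 1 ≤ j → j ≤ J → v 0 < v j := by
    intro j h1 h2
    by_contra! hle
    have h1' : (1 : ℤ) ≤ j := by exact_mod_cast h1
    have hdrop : (j : ℤ) * q ≤ u 0 - u j := by
      by_contra! hc
      have : u 0 - u j + 1 ≤ j * q := hc
      nlinarith [huv j, hlt 0, hnonneg j]
    nlinarith [hlong j h1 h2]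
  obtain ⟨p, hpmem, hpmin⟩ := Finset.exists_min_image (Finset.Icc 1 J) v
    ⟨1, Finset.mem_Icc.2 ⟨le_rfl, hJ1⟩⟩
  obtain ⟨hp1, hpJ⟩ := Finset.mem_Icc.1 hpmem
  have hp1' : (1 : ℤ) ≤ p := by exact_mod_cast hp1
  obtain ⟨i, rfl⟩ := Nat.exists_eq_add_of_le hpJ
  set d : ℤ := v p - v 0 with hd
  have hdpos : 0 < d := by linarith [habove p hp1 hpJ]
  have hdq : q + 1 ≤ d := by
    have hdrop : (p : ℤ) * q + 1 ≤ u 0 - u p := by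
      by_contra! hc
      have : u 0 - u p ≤ p * q := by linarith
      nlinarith [huv p]
    nlinarith [hlong p hp1 hpJ]
  have hstep : ∀ j, b * (u j - u (j + 1)) = a + v (j + 1) - v j := by
    intro j
    have h1 := huv j
    have h2 := huv (j + 1)
    push_cast at h2
    linarith
  have hstep_le : ∀ j, u j - u (j + 1) ≤ q + 1 := by
    intro j
    by_contra! hc
    nlinarith [hstep j, hlt (j + 1), hnonneg j]
  have hsteps : ∀ t : ℕ, u p - u (p + t) ≤ t * (q + 1) := by
    intro t
    induction t with
    | zero => simp
    | succ t ih =>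
      have := hstep_le (p + t)
      rw [← add_assoc]
      push_cast
      linarith
  -- `m - (J + 1) * a` is negative; this bounds `u p` from above through the steps.
  have hend : u (p + i + 1) ≤ -1 := by
    by_contra! hc
    have h := huv (p + i + 1)
    push_cast at h hmJ
    nlinarith [hnonneg (p + i + 1)]
  have hlast := hlong p hp1 hpJ
  have hmany := hsteps i
  have hmin : ∀ j : ℕ, 1 ≤ j → j ≤ p + i → m % b + d ≤ (m - j * a) % b := by
    intro j h1 h2
    have := hpmin j (Finset.mem_Icc.2 ⟨h1, h2⟩)
    rw [← hv0]
    linarith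
  have hpd : (m - p * a) % b = m % b + d := by
    rw [← hv0, hd]
    simp [hv]
  have hi0 : (0 : ℤ) ≤ i := by positivity
  have hid : (i : ℤ) * (q + 1) ≤ i * d := mul_le_mul_of_nonneg_left hdq hi0
  -- A rise in the last residue may cost one more in the quotient, but supplies one more point to
  -- pack.
  by_cases hcarry : v (p + i) < v (p + i + 1)
  · have hpack := orbit_packing (a := a) (N := p + i + 1) (i := i) (p := p) hb (by omega) hp1
      hdpos (fun j h1 h2 => by
        rcases Nat.lt_or_ge (p + i) j with h3 | h3
        · obtain rfl : j = p + i + 1 := by omega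
          exact (hmin (p + i) (by omega) le_rfl).trans hcarry.le
        · exact hmin j h1 h3) hpd
    rw [← hv0] at hpack
    push_cast at hpack
    linarith [hstep_le (p + i)]
  · have hpack := orbit_packing (a := a) (N := p + i) (i := i) (p := p) hb (by omega) hp1
      hdpos hmin hpd
    rw [← hv0] at hpack
    push_cast at hpack
    have hq' : u (p + i) - u (p + i + 1) ≤ q := by
      by_contra! hc
      have : q + 1 ≤ u (p + i) - u (p + i + 1) := hc
      nlinarith [hstep (p + i)]
    linarith

theorem hasRep_of_le_hRange {a₂ a₃ : ℕ} (h₂ : 1 < a₂) (h₃ : a₂ < a₃) {h x : ℕ}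
    (hx : x ≤ hRange a₂ a₃ h) : HasRep a₂ a₃ h x := by
  by_contra hcon
  have := (isLeast_hRange_add_one h₂ h₃ h).2 hcon
  omega

theorem le_hRange_of_forall_hasRep {a₂ a₃ : ℕ} (h₂ : 1 < a₂) (h₃ : a₂ < a₃) {h n : ℕ}
    (hn : ∀ x ≤ n, HasRep a₂ a₃ h x) : n ≤ hRange a₂ a₃ h := by
  by_contra! hcon
  exact (isLeast_hRange_add_one h₂ h₃ h).1 (hn _ hcon)

/-- With `q = a₃ / a₂`, the number `q * a₂ - 1 < a₃` needs `(q - 1) + (a₂ - 1)` summands. -/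
theorem Admissible.add_div_le {a₂ a₃ : ℕ} (h₂ : 1 < a₂) (h₃ : a₂ < a₃) {h : ℕ}
    (hadm : Admissible a₂ a₃ h) : a₂ + a₃ / a₂ ≤ h + 2 := by
  have hqa : a₃ / a₂ * a₂ ≤ a₃ := Nat.div_mul_le_self _ _
  have hq : 1 ≤ a₃ / a₂ := (Nat.one_le_div_iff (by omega)).2 h₃.le
  generalize a₃ / a₂ = q at hqa hq ⊢
  have hpos : 0 < q * a₂ := Nat.mul_pos hq (by omega)
  obtain ⟨c₁, c₂, c₃, hx, hc⟩ := hasRep_of_le_hRange h₂ h₃ (h := h) (x := q * a₂ - 1)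
    (le_trans (by omega) hadm)
  have hc₃ : c₃ = 0 := by
    by_contra hne
    have : a₃ ≤ c₃ * a₃ := Nat.le_mul_of_pos_left _ (Nat.pos_of_ne_zero hne)
    omega
  subst hc₃
  have hx' : q * a₂ = c₂ * a₂ + c₁ + 1 := by omega
  have hlt : c₂ < q := by
    by_contra! hle
    have := Nat.mul_le_mul_right a₂ hle
    omega
  obtain ⟨t, rfl⟩ := Nat.exists_eq_add_of_lt hlt
  nlinarith

theorem hRange_succ_of_admissible {a₂ a₃ : ℕ} (h₂ : 1 < a₂) (h₃ : a₂ < a₃) {h : ℕ}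
    (hadm : Admissible a₂ a₃ h) : hRange a₂ a₃ (h + 1) = hRange a₂ a₃ h + a₃ := by
  have hadm' : a₃ ≤ hRange a₂ a₃ h := hadm
  apply le_antisymm
  · by_contra! hcon
    refine (isLeast_hRange_add_one h₂ h₃ h).1 ?_
    obtain ⟨c₁, c₂, c₃, hx, hc⟩ := hasRep_of_le_hRange h₂ h₃ (h := h + 1)
      (x := hRange a₂ a₃ h + 1 + a₃) (by omega)
    generalize hRange a₂ a₃ h = X at *
    rcases c₃ with _ | c₃
    · have hb : (0 : ℤ) < a₂ := by exact_mod_cast (by omega : 0 < a₂)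
      have hq : 1 ≤ a₃ / a₂ := (Nat.one_le_div_iff (by omega)).2 h₃.le
      have hh := hadm.add_div_le h₂ h₃
      have hqa : a₃ / a₂ * a₂ ≤ a₃ := Nat.div_mul_le_self _ _
      have haq : a₃ < (a₃ / a₂ + 1) * a₂ := by
        rw [mul_comm]
        exact Nat.lt_mul_div_succ _ (by omega)
      generalize a₃ / a₂ = q at *
      have hgreedy : ((X + 1 + a₃ : ℕ) : ℤ) / a₂ + ((X + 1 + a₃ : ℕ) : ℤ) % a₂ ≤ h + 1 := by
        rw [hx, zero_mul, zero_add]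
        have h1 : c₁ / a₂ + c₁ % a₂ ≤ c₁ := by
          have := Nat.div_add_mod c₁ a₂
          nlinarith [Nat.zero_le (c₁ / a₂)]
        have h2 : (c₂ * a₂ + c₁) / a₂ = c₂ + c₁ / a₂ := by
          rw [add_comm, Nat.add_mul_div_right _ _ (by omega), add_comm]
        have h3 : (c₂ * a₂ + c₁) % a₂ = c₁ % a₂ := by simp
        have h4 : (c₂ * a₂ + c₁) / a₂ + (c₂ * a₂ + c₁) % a₂ ≤ h + 1 := by omega
        exact_mod_cast h4
      obtain ⟨j, hj1, hjm, hj⟩ := exists_rep_using_largest (m := ((X + 1 + a₃ : ℕ) : ℤ))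
        (a := a₃) (q := q) (H := h + 1) hb (by exact_mod_cast hq) (by exact_mod_cast hqa)
        (by exact_mod_cast haq) (by push_cast; linarith) hgreedy (by omega)
      have hjm' : j * a₃ ≤ X + 1 + a₃ := by exact_mod_cast hjm
      obtain ⟨y, hy⟩ := Nat.exists_eq_add_of_le hjm'
      have hy' : ((X + 1 + a₃ : ℕ) : ℤ) - j * a₃ = (y : ℤ) := by
        rw [hy]
        push_cast
        ring
      rw [hy'] at hj
      have hj' : j + y / a₂ + y % a₂ ≤ h + 1 := by exact_mod_cast hj
      obtain ⟨k, rfl⟩ := Nat.exists_eq_add_of_le hj1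
      -- One of the `1 + k` copies of `a₃` is dropped.
      refine ⟨y % a₂, y / a₂, k, ?_, by omega⟩
      have := Nat.div_add_mod y a₂
      nlinarith
    · exact ⟨c₁, c₂, c₃, by nlinarith, by omega⟩
  · refine le_hRange_of_forall_hasRep h₂ h₃ fun x hx => ?_
    rcases le_total x a₃ with hle | hle
    · obtain ⟨c₁, c₂, c₃, hx', hc⟩ := hasRep_of_le_hRange h₂ h₃ (hle.trans hadm')
      exact ⟨c₁, c₂, c₃, hx', by omega⟩
    · obtain ⟨c₁, c₂, c₃, hx', hc⟩ := hasRep_of_le_hRange h₂ h₃ (h := h) (x := x - a₃) (by omega)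
      refine ⟨c₁, c₂, c₃ + 1, ?_, by omega⟩
      rw [add_mul]
      omega

theorem admissible_self {a₂ a₃ : ℕ} (h₂ : 1 < a₂) (h₃ : a₂ < a₃) : Admissible a₂ a₃ a₃ :=
  le_hRange_of_forall_hasRep h₂ h₃ fun x hx => ⟨x, 0, 0, by simp, by simpa using hx⟩

theorem Admissible.mono {a₂ a₃ : ℕ} (h₂ : 1 < a₂) (h₃ : a₂ < a₃) {h h' : ℕ} (hle : h ≤ h')
    (hadm : Admissible a₂ a₃ h) : Admissible a₂ a₃ h' := by
  induction h', hle using Nat.le_induction with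
  | base => exact hadm
  | succ k _ ih =>
    have := hRange_succ_of_admissible h₂ h₃ ih
    unfold Admissible
    omega

end HBasis

theorem theorem3 (a₂ a₃ : ℕ) (h₂ : 1 < a₂) (h₃ : a₂ < a₃) :
    (∀ h : ℕ, HBasis.Admissible a₂ a₃ h →
      HBasis.hRange a₂ a₃ (h + 1) = HBasis.hRange a₂ a₃ h + a₃) ∧
    (∃ h₀ h₁ : ℕ, HBasis.IsHZero a₂ a₃ h₀ ∧ HBasis.IsHOne a₂ a₃ h₁ ∧ h₁ ≤ h₀) := by
  refine ⟨fun h hadm => HBasis.hRange_succ_of_admissible h₂ h₃ hadm, ?_⟩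
  have hne : {h : ℕ | HBasis.Admissible a₂ a₃ h}.Nonempty := ⟨a₃, HBasis.admissible_self h₂ h₃⟩
  have hmem : sInf {h : ℕ | HBasis.Admissible a₂ a₃ h} ∈
      {m : ℕ | ∀ h : ℕ, m ≤ h → HBasis.hRange a₂ a₃ (h + 1) = HBasis.hRange a₂ a₃ h + a₃} :=
    fun h hle => HBasis.hRange_succ_of_admissible h₂ h₃
      (HBasis.Admissible.mono h₂ h₃ hle (Nat.sInf_mem hne))
  exact ⟨_, _, ⟨Nat.sInf_mem hne, fun _ h => Nat.sInf_le h⟩,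
    ⟨Nat.sInf_mem ⟨_, hmem⟩, fun _ h => Nat.sInf_le h⟩, Nat.sInf_le hmem⟩
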